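/- **Theorem (Superadditivity of Fisher informations).** Let $0<s\le 1$, let $n<N$ be two (nonnegative) integers, and let $\mu_N$ be a probability measure on $(\mathbb{R}^{d})^N=\mathbb{R}^{dN}$ that is symmetric, i.e. invariant under all permutations of the $N$ variables $x_1,\dots,x_N\in\mathbb{R}^d$. For $k\le N$ let $\mu_N^{(k)}$ be the $k$-th marginal of $\mu_N$, i.e. the law of $(x_1,\dots,x_k)$ under $\mu_N$; if $\mu_N$ has a Lebesgue density, also denoted $\mu_N$, it has the density $$\mu_N^{(k)}(x_1,\dots,x_k)=\int_{\mathbb{R}^{d(N-k)}}\mu_N(x_1,\dots,x_k,y_{k+1},\dots,y_N)\,dy_{k+1}\cdots dy_N .$$ For a probability measure $\mu$ on $\mathbb{R}^{dM}$ with a Lebesgue density, again denoted $\mu$, define the Fisher information ($s=1$), respectively the fractional Fisher information of order $s$ ($0<s<1$), by the quadratic form $$\mathcal{I}_s[\mu]=\Big\langle \sqrt{\mu}\,\Big|\,\sum_{j=1}^{M}(-\Delta_{x_j})^s\,\Big|\,\sqrt{\mu}\Big\rangle_{L^2(\mathbb{R}^{dM})}=\sum_{j=1}^{M}\int_{\mathbb{R}^{dM}}|2\pi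 k_j|^{2s}\,\big|\widehat{\sqrt{\mu}}(k)\big|^2\,dk\in[0,+\infty],$$ where $\widehat{f}(k)=\int e^{-2\pi i k\cdot x}f(x)\,dx$ is the Fourier transform on $L^2(\mathbb{R}^{dM})$ and $k=(k_1,\dots,k_M)$ with $k_j\in\mathbb{R}^d$; put $\mathcal{I}_s[\mu]=+\infty$ if $\mu$ has no density. Then, in $[0,+\infty]$, $$\mathcal{I}_s[\mu_N]\;\ge\;\mathcal{I}_s\big[\mu_N^{(n)}\big]+\mathcal{I}_s\big[\mu_N^{(N-n)}\big].$$ -/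

import Mathlib

open MeasureTheory
open scoped ENNReal FourierTransform

noncomputable section

/-- The configuration space `(ℝ^d)^N = ℝ^{dN}` with its Euclidean structure and Lebesgue measure;
the coordinate `(j, i)` is the `i`-th coordinate of the `j`-th particle. -/
abbrev Config (d N : ℕ) : Type := EuclideanSpace ℝ (Fin N × Fin d)

/-- The configuration whose `j`-th particle is the `f j`-th particle of `x`. -/
def Config.reindex {d N n : ℕ} (f : Fin n → Fin N) (x : Config d N) : Config d n :=
  WithLp.toLp 2 fun p => x (f p.1, p.2)

/-- The position `x_j ∈ ℝ^d` of the `j`-th particle of the configuration `x`. -/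
def Config.particle {d N : ℕ} (x : Config d N) (j : Fin N) : EuclideanSpace ℝ (Fin d) :=
  WithLp.toLp 2 fun i => x (j, i)

theorem Config.measurable_reindex {d N n : ℕ} (f : Fin n → Fin N) :
    Measurable (Config.reindex f : Config d N → Config d n) := by
  unfold Config.reindex
  fun_prop

/-- Symmetry of a probability measure on `(ℝ^d)^N` under permutations of the `N` particles. -/
def IsSymmetric {d N : ℕ} (μ : ProbabilityMeasure (Config d N)) : Prop :=
  ∀ σ : Equiv.Perm (Fin N), μ.map (Config.measurable_reindex σ).aemeasurable = μ

/-- The `n`-th marginal `μ^{(n)}` of `μ`: the law of the first `n` particles. -/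
def marginal {d N : ℕ} (μ : ProbabilityMeasure (Config d N)) (n : ℕ) (h : n ≤ N) :
    ProbabilityMeasure (Config d n) :=
  μ.map (Config.measurable_reindex (Fin.castLE h)).aemeasurable

/-- The square root of the Lebesgue density of `μ`. -/
def sqrtDensityFun {d N : ℕ} (μ : ProbabilityMeasure (Config d N)) (x : Config d N) : ℂ :=
  (Real.sqrt (((μ : Measure (Config d N)).rnDeriv volume x).toReal) : ℂ)

theorem memLp_sqrtDensityFun {d N : ℕ} (μ : ProbabilityMeasure (Config d N)) :
    MemLp (sqrtDensityFun μ) 2 volume := by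
  have hm : Measurable (sqrtDensityFun μ) := by
    unfold sqrtDensityFun
    exact Complex.measurable_ofReal.comp
      ((Measure.measurable_rnDeriv _ _).ennreal_toReal.sqrt)
  rw [memLp_two_iff_integrable_sq_norm hm.aestronglyMeasurable]
  refine (Measure.integrable_toReal_rnDeriv (μ := (μ : Measure (Config d N)))
    (ν := volume)).congr (Filter.Eventually.of_forall fun x => ?_)
  simp [sqrtDensityFun, Real.sq_sqrt]

/-- The wave function `√μ ∈ L²(ℝ^{dN}, ℂ)`. -/
def sqrtDensity {d N : ℕ} (μ : ProbabilityMeasure (Config d N)) :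
    Lp ℂ 2 (volume : Measure (Config d N)) :=
  (memLp_sqrtDensityFun μ).toLp (sqrtDensityFun μ)

/-- The quadratic form `⟨Ψ, (-Δ_{x_j})^s Ψ⟩ ∈ [0, ∞]` on `L²(ℝ^{dN}, ℂ)`, where `(-Δ_{x_j})^s` is the
Fourier multiplier with symbol `|2π k_j|^{2s}`, since `𝓕 Ψ (k) = ∫ e^{-2πi⟨k, x⟩} Ψ(x) dx` here.
It is `∞` exactly when `Ψ` is outside the form domain. -/
def kineticForm {d N : ℕ} (s : ℝ) (j : Fin N) (Ψ : Lp ℂ 2 (volume : Measure (Config d N))) : ℝ≥0∞ :=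
  ∫⁻ k : Config d N,
    ENNReal.ofReal ((2 * Real.pi * ‖k.particle j‖) ^ (2 * s) *
      ‖(𝓕 Ψ : Lp ℂ 2 (volume : Measure (Config d N))) k‖ ^ 2)

open Classical in
/-- The (fractional) Fisher information `I_s[μ] = ⟨√μ, ∑_j (-Δ_{x_j})^s √μ⟩ ∈ [0, ∞]`,
which is `∞` when `μ` has no density with respect to Lebesgue measure. -/
def fisherInformation {d N : ℕ} (s : ℝ) (μ : ProbabilityMeasure (Config d N)) : ℝ≥0∞ :=
  if (μ : Measure (Config d N)) ≪ volume then
    ∑ j : Fin N, kineticForm s j (sqrtDensity μ)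
  else ∞

end

/-!
The kinetic energy of each single particle does not increase when the other particles are integrated
out (`kineticForm_sqrtDensity_map_reindex_le`). This gives superadditivity: by symmetry the marginal
of order `N - n` is the law of the last `N - n` particles, so the two marginals involve disjoint sets
of particles, and the sum of their kinetic energies is at most the sum over all particles. If `μ` has
no density there is nothing to prove, and otherwise the marginals have densities as well.

The energy of one particle is reduced to translations. Plancherel's theorem
(`lintegral_norm_fourierChar_sub_one_sq`) and a Gaussian average over displacements `h` of particle
`j` express the form of `1 - e^{tΔ_j}` through the squared distances `‖Ψ(· + h) - Ψ‖²`
(`two_mul_lintegral_heat_fourierDensity`), and `(-Δ_j)^s` is recovered from these forms by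
subordination for `s < 1` and by the limit `t → 0` for `s = 1`
(`lintegral_rpow_two_mul_le_of_heat`).

For probability densities, `‖√p - √q‖² = 2 - 2 ∫ √(p q)`, so the distances decrease under marginals
because the Hellinger affinity `∫ √(p q)` increases under pushforward
(`lintegral_sqrt_mul_le_of_map_withDensity`). The latter is proved by a weighted arithmetic-geometric
mean inequality, without disintegrating the measures.
-/

/-! ### Translations and the Fourier transform on `L²` -/

section Translation

variable {E : Type*} [NormedAddCommGroup E] [InnerProductSpace ℝ E] [FiniteDimensional ℝ E]
  [MeasurableSpace E] [BorelSpace E]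

theorem memLp_top_fourierChar_inner (v : E) :
    MemLp (fun k : E => ((𝐞 (inner ℝ v k) : Circle) : ℂ)) ∞ volume := by
  refine memLp_top_of_bound (Continuous.aestronglyMeasurable ?_) 1
    (Filter.Eventually.of_forall fun k => (Circle.norm_coe _).le)
  exact continuous_subtype_val.comp (Real.continuous_fourierChar.comp (by fun_prop))

/-- On `L²`, translation by `v` becomes multiplication by the phase `𝐞 ⟪v, k⟫`. Both sides are
continuous in `f`, so it suffices to compare them on Schwartz functions, where the Fourier
transform is an integral. -/
theorem fourier_compMeasurePreserving_add_right (v : E) (f : Lp ℂ 2 (volume : Measure E)) :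
    (𝓕 (Lp.compMeasurePreserving (· + v) (measurePreserving_add_right volume v) f) :
      Lp ℂ 2 (volume : Measure E)) =
    (ContinuousLinearMap.mul ℝ ℂ).holderL volume ∞ 2 2
      (memLp_top_fourierChar_inner v).toLp (𝓕 f : Lp ℂ 2 (volume : Measure E)) := by
  refine DenseRange.induction_on (p := fun f : Lp ℂ 2 (volume : Measure E) =>
    (𝓕 (Lp.compMeasurePreserving (· + v) (measurePreserving_add_right volume v) f) :
      Lp ℂ 2 (volume : Measure E)) =
    (ContinuousLinearMap.mul ℝ ℂ).holderL volume ∞ 2 2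
      (memLp_top_fourierChar_inner v).toLp (𝓕 f : Lp ℂ 2 (volume : Measure E)))
    (SchwartzMap.denseRange_toLpCLM (p := 2) ENNReal.ofNat_ne_top) f ?_ ?_
  · refine isClosed_eq ?_ ?_
    · exact (Lp.fourierTransformₗᵢ E ℂ).continuous.comp
        (Lp.isometry_compMeasurePreserving (measurePreserving_add_right volume v)).continuous
    · exact (ContinuousLinearMap.continuous _).comp (Lp.fourierTransformₗᵢ E ℂ).continuous
  · intro g
    have h1 : Lp.compMeasurePreserving (· + v) (measurePreserving_add_right volume v)
        (SchwartzMap.toLpCLM ℝ ℂ 2 volume g) =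
        (SchwartzMap.compSubConstCLM ℝ (-v) g).toLp 2 := by
      apply Lp.ext
      have hg := (measurePreserving_add_right (volume : Measure E)
        v).quasiMeasurePreserving.ae_eq_comp (g.coeFn_toLp 2 volume)
      filter_upwards [Lp.coeFn_compMeasurePreserving (SchwartzMap.toLpCLM ℝ ℂ 2 volume g)
        (measurePreserving_add_right volume v), hg,
        (SchwartzMap.compSubConstCLM ℝ (-v) g).coeFn_toLp 2 volume] with x h1 h2 h3
      rw [h1, h3]
      simpa using h2
    rw [h1, SchwartzMap.toLpCLM_apply, SchwartzMap.toLp_fourier_eq, SchwartzMap.toLp_fourier_eq]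
    apply Lp.ext
    filter_upwards [(𝓕 (SchwartzMap.compSubConstCLM ℝ (-v) g)).coeFn_toLp 2 volume,
      (𝓕 g).coeFn_toLp 2 volume, (memLp_top_fourierChar_inner v).coeFn_toLp,
      (ContinuousLinearMap.mul ℝ ℂ).coeFn_holder (r := 2) (memLp_top_fourierChar_inner v).toLp
        ((𝓕 g).toLp 2 volume)] with k h1 h2 h3 h4
    rw [ContinuousLinearMap.holderL_apply_apply, h4, h1, h2, h3, SchwartzMap.fourier_coe,
      SchwartzMap.fourier_coe]
    have := congrFun (VectorFourier.fourierIntegral_comp_add_right 𝐞 volume (innerₗ E)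
      (g : E → ℂ) v) k
    have hc : (SchwartzMap.compSubConstCLM ℝ (-v) g : E → ℂ) = g ∘ fun x => x + v := by
      ext x; simp
    rw [hc]
    exact this

/-- Plancherel's theorem for the difference of a function and its translate. -/
theorem lintegral_norm_fourierChar_sub_one_sq (v : E) (f : Lp ℂ 2 (volume : Measure E)) :
    ∫⁻ k : E, ENNReal.ofReal (‖((𝐞 (inner ℝ v k) : Circle) : ℂ) - 1‖ ^ 2) *
        ENNReal.ofReal (‖(𝓕 f : Lp ℂ 2 (volume : Measure E)) k‖ ^ 2) =
      ∫⁻ x : E, ENNReal.ofReal (‖f (x + v) - f x‖ ^ 2) := by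
  set g := Lp.compMeasurePreserving (· + v) (measurePreserving_add_right volume v) f with hg
  have key : ‖(𝓕 g - 𝓕 f : Lp ℂ 2 (volume : Measure E))‖ₑ = ‖g - f‖ₑ := by
    have : (𝓕 g - 𝓕 f : Lp ℂ 2 (volume : Measure E)) = Lp.fourierTransformₗᵢ E ℂ (g - f) :=
      (map_sub (Lp.fourierTransformₗᵢ E ℂ) g f).symm
    rw [this, LinearIsometryEquiv.enorm_map]
  have sq : ∀ h : Lp ℂ 2 (volume : Measure E),
      ‖h‖ₑ ^ 2 = ∫⁻ x, ENNReal.ofReal (‖h x‖ ^ 2) := by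
    intro h
    rw [Lp.enorm_def, eLpNorm_eq_lintegral_rpow_enorm_toReal (by simp) (by simp)]
    rw [← ENNReal.rpow_natCast, ← ENNReal.rpow_mul]
    simp [ENNReal.ofReal_pow]
  have key2 := congrArg (· ^ 2) key
  simp only [sq] at key2
  have hv := (measurePreserving_add_right (volume : Measure E) v)
  calc _ = ∫⁻ k, ENNReal.ofReal (‖(𝓕 g - 𝓕 f : Lp ℂ 2 (volume : Measure E)) k‖ ^ 2) := by
        refine lintegral_congr_ae ?_
        have := fourier_compMeasurePreserving_add_right v f
        filter_upwards [Lp.coeFn_sub (𝓕 g : Lp ℂ 2 (volume : Measure E)) (𝓕 f),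
          (memLp_top_fourierChar_inner v).coeFn_toLp,
          (ContinuousLinearMap.mul ℝ ℂ).coeFn_holder (r := 2) (memLp_top_fourierChar_inner v).toLp
          (𝓕 f : Lp ℂ 2 (volume : Measure E))] with k h1 h2 h3
        rw [h1, Pi.sub_apply, hg, this, ContinuousLinearMap.holderL_apply_apply, h3, h2,
          ← ENNReal.ofReal_mul (by positivity), ← mul_pow, ← norm_mul, sub_mul, one_mul]
        rfl
    _ = ∫⁻ x, ENNReal.ofReal (‖(g - f) x‖ ^ 2) := key2
    _ = _ := by
        refine lintegral_congr_ae ?_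
        filter_upwards [Lp.coeFn_sub g f, Lp.coeFn_compMeasurePreserving f hv] with x h1 h2
        rw [h1, Pi.sub_apply, hg, h2]
        rfl

end Translation

/-! ### Gaussian averages and subordination -/

section Subordination

open ProbabilityTheory in
/-- Averaging `‖𝐞 ⟪c h, k⟫ - 1‖²` over a standard Gaussian `h` gives the symbol of one minus a heat
semigroup: `‖e^{iθ} - 1‖² = 2 - 2 cos θ`, and the mean of the cosine is the real part of the Gaussian
characteristic function. -/
theorem lintegral_stdGaussian_fourierChar_sub_one {E : Type*} [NormedAddCommGroup E]
    [InnerProductSpace ℝ E] [FiniteDimensional ℝ E] [MeasurableSpace E] [BorelSpace E]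
    (c : ℝ) (k : E) :
    ∫⁻ h, ENNReal.ofReal (‖((𝐞 (inner ℝ (c • h) k) : Circle) : ℂ) - 1‖ ^ 2) ∂stdGaussian E =
      ENNReal.ofReal (2 * (1 - Real.exp (-(2 * Real.pi * c * ‖k‖) ^ 2 / 2))) := by
  have hpt : ∀ h : E, ‖((𝐞 (inner ℝ (c • h) k) : Circle) : ℂ) - 1‖ ^ 2 =
      2 - 2 * (Complex.exp (inner ℝ h ((2 * Real.pi * c) • k) * Complex.I)).re := by
    intro h
    have hθ : 2 * Real.pi * inner ℝ (c • h) k = inner ℝ h ((2 * Real.pi * c) • k) := by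
      rw [real_inner_smul_left, real_inner_smul_right]
      ring
    rw [Real.fourierChar_apply, hθ, ← Complex.normSq_eq_norm_sq, Complex.normSq_apply]
    simp only [Complex.sub_re, Complex.sub_im, Complex.exp_ofReal_mul_I_re,
      Complex.exp_ofReal_mul_I_im, Complex.one_re, Complex.one_im]
    linear_combination Real.sin_sq_add_cos_sq (inner ℝ h ((2 * Real.pi * c) • k))
  have hint : Integrable (fun h : E =>
      Complex.exp (inner ℝ h ((2 * Real.pi * c) • k) * Complex.I)) (stdGaussian E) := by
    refine Integrable.of_bound (Continuous.aestronglyMeasurable (by fun_prop)) 1 ?_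
    filter_upwards with h
    rw [Complex.norm_exp_ofReal_mul_I]
  have hre : Integrable (fun h : E =>
      (Complex.exp (inner ℝ h ((2 * Real.pi * c) • k) * Complex.I)).re) (stdGaussian E) := hint.re
  rw [← ofReal_integral_eq_lintegral_ofReal]
  · simp_rw [hpt]
    have h1 : ∫ h : E, (Complex.exp (inner ℝ h ((2 * Real.pi * c) • k) * Complex.I)).re
        ∂stdGaussian E = Real.exp (-(2 * Real.pi * c * ‖k‖) ^ 2 / 2) := by
      have h2 := charFun_stdGaussian (E := E) ((2 * Real.pi * c) • k)
      rw [charFun_apply] at h2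
      have h3 := integral_re hint
      simp only [RCLike.re_to_complex] at h3
      rw [h3, h2, norm_smul, Real.norm_eq_abs, mul_comm |_|, ← Complex.ofReal_pow,
        ← Complex.ofReal_neg, ← Complex.ofReal_ofNat, ← Complex.ofReal_div, Complex.exp_ofReal_re,
        mul_pow, sq_abs]
      congr 1
      ring
    rw [integral_sub (integrable_const _) (hre.const_mul 2), integral_const_mul, h1]
    simp [mul_sub]
  · simp_rw [hpt]
    exact (integrable_const _).sub (hre.const_mul 2)
  · filter_upwards with h using by positivity

/-- The constant `C_s = ∫₀^∞ t^{-1-s} (1 - e^{-t}) dt` in Bochner's subordination formula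
`C_s λ^s = ∫₀^∞ t^{-1-s} (1 - e^{-tλ}) dt`; it is finite for `0 < s < 1`. -/
noncomputable def subordinationConst (s : ℝ) : ℝ≥0∞ :=
  ∫⁻ t in Set.Ioi (0 : ℝ), ENNReal.ofReal (t ^ (-1 - s) * (1 - Real.exp (-t)))

theorem subordinationConst_ne_zero (s : ℝ) : subordinationConst s ≠ 0 := by
  have hm : Measurable fun t : ℝ => ENNReal.ofReal (t ^ (-1 - s) * (1 - Real.exp (-t))) := by
    fun_prop
  rw [subordinationConst, Ne, lintegral_eq_zero_iff hm]
  intro h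
  rw [Filter.EventuallyEq, ae_restrict_iff' measurableSet_Ioi] at h
  have : (volume : Measure ℝ) (Set.Ioi 0) = 0 := by
    refine measure_mono_null (fun t ht => ?_) h
    have ht : 0 < t := ht
    simp only [Set.mem_compl_iff, Set.mem_ofPred_eq, not_forall]
    refine ⟨ht, ?_⟩
    have : 0 < t ^ (-1 - s) * (1 - Real.exp (-t)) :=
      mul_pos (Real.rpow_pos_of_pos ht _) (by simpa using ht)
    simpa using this
  simp at this

theorem subordinationConst_ne_top {s : ℝ} (hs0 : 0 < s) (hs1 : s < 1) :
    subordinationConst s ≠ ∞ := by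
  have hpos : ∀ t : ℝ, 0 < t → 0 ≤ t ^ (-1 - s) * (1 - Real.exp (-t)) := fun t ht =>
    mul_nonneg (Real.rpow_nonneg ht.le _) (by simpa using ht.le)
  have hmeas : Measurable fun t : ℝ => t ^ (-1 - s) * (1 - Real.exp (-t)) := by fun_prop
  have h1 : IntegrableOn (fun t : ℝ => t ^ (-1 - s) * (1 - Real.exp (-t))) (Set.Ioc 0 1) := by
    -- Near zero, `1 - e^{-t} ≤ t` leaves the integrable function `t^{-s}`.
    have := (intervalIntegral.intervalIntegrable_rpow' (a := 0) (b := 1)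
      (show -1 < -s by linarith)).1
    refine Integrable.mono' this hmeas.aestronglyMeasurable ?_
    filter_upwards [ae_restrict_mem measurableSet_Ioc] with t ht
    rw [Real.norm_of_nonneg (hpos t ht.1), show -s = (-1 - s) + 1 by ring,
      Real.rpow_add_one ht.1.ne']
    gcongr
    · exact Real.rpow_nonneg ht.1.le _
    · linarith [Real.add_one_le_exp (-t)]
  have h2 : IntegrableOn (fun t : ℝ => t ^ (-1 - s) * (1 - Real.exp (-t))) (Set.Ioi 1) := by
    have := integrableOn_Ioi_rpow_of_lt (show -1 - s < -1 by linarith) one_pos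
    refine Integrable.mono' this hmeas.aestronglyMeasurable ?_
    filter_upwards [ae_restrict_mem measurableSet_Ioi] with t ht
    have ht : 1 < t := ht
    rw [Real.norm_of_nonneg (hpos t (by linarith))]
    refine mul_le_of_le_one_right (Real.rpow_nonneg (by linarith) _) ?_
    linarith [Real.exp_pos (-t)]
  have h := h1.union h2
  rw [Set.Ioc_union_Ioi_eq_Ioi zero_le_one] at h
  exact h.lintegral_lt_top.ne

/-- The subordination formula for `λ = a²`, by the substitution `t ↦ a² t`. -/
theorem lintegral_rpow_mul_one_sub_exp {s a : ℝ} (hs0 : 0 < s) (ha : 0 ≤ a) :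
    ∫⁻ t in Set.Ioi (0 : ℝ), ENNReal.ofReal (t ^ (-1 - s)) *
        ENNReal.ofReal (1 - Real.exp (-(t * a ^ 2))) =
      subordinationConst s * ENNReal.ofReal (a ^ (2 * s)) := by
  rcases ha.eq_or_lt with rfl | ha
  · simp [Real.zero_rpow (show 2 * s ≠ 0 by positivity)]
  have hb : 0 < a ^ 2 := by positivity
  have hcv := lintegral_image_eq_lintegral_abs_deriv_mul measurableSet_Ioi
    (s := Set.Ioi (0 : ℝ)) (f := fun t => a ^ 2 * t) (f' := fun _ => a ^ 2)
    (fun t _ => by simpa using ((hasDerivAt_id t).const_mul (a ^ 2)).hasDerivWithinAt)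
    (mul_right_injective₀ hb.ne').injOn
    (fun t => ENNReal.ofReal (t ^ (-1 - s) * (1 - Real.exp (-t))))
  rw [Set.image_const_mul_Ioi_zero hb] at hcv
  rw [subordinationConst, hcv, mul_comm, ← lintegral_const_mul' _ _ ENNReal.ofReal_ne_top]
  refine setLIntegral_congr_fun measurableSet_Ioi fun t ht => ?_
  have ht : 0 < t := ht
  have hp : a ^ (2 * s) * (a ^ 2 * (a ^ 2) ^ (-1 - s)) = 1 := by
    rw [Real.rpow_mul ha.le, Real.rpow_two]
    nth_rewrite 2 [← Real.rpow_one (a ^ 2)]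
    rw [← Real.rpow_add hb, ← Real.rpow_add hb, show s + (1 + (-1 - s)) = 0 by ring,
      Real.rpow_zero]
  have ht' : 0 ≤ t ^ (-1 - s) := Real.rpow_nonneg ht.le _
  rw [← ENNReal.ofReal_mul ht', abs_of_pos hb, ← ENNReal.ofReal_mul hb.le,
    ← ENNReal.ofReal_mul (by positivity), Real.mul_rpow hb.le ht.le]
  congr 1
  rw [mul_comm t]
  linear_combination -(t ^ (-1 - s) * (1 - Real.exp (-(a ^ 2 * t)))) * hp

theorem subordinationConst_mul_lintegral {α : Type*} [MeasurableSpace α] {ν : Measure α}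
    [SFinite ν] {s : ℝ} (hs0 : 0 < s) {a : α → ℝ} (ha : Measurable a) (ha0 : ∀ x, 0 ≤ a x) :
    subordinationConst s * ∫⁻ x, ENNReal.ofReal (a x ^ (2 * s)) ∂ν =
      ∫⁻ t in Set.Ioi (0 : ℝ), ENNReal.ofReal (t ^ (-1 - s)) *
        ∫⁻ x, ENNReal.ofReal (1 - Real.exp (-(t * a x ^ 2))) ∂ν := by
  rw [← lintegral_const_mul _ (by fun_prop)]
  simp_rw [← lintegral_rpow_mul_one_sub_exp hs0 (ha0 _)]
  rw [lintegral_lintegral_swap (by fun_prop)]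
  simp_rw [lintegral_const_mul' _ _ ENNReal.ofReal_ne_top]

/-- If the integral of `1 - e^{-ta²}` is at most that of `1 - e^{-tb²}` for every `t > 0`, then the
integral of `a^{2s}` is at most that of `b^{2s}`. For `s < 1` this is subordination; for
`s = 1`, where the constant is infinite, it is `a² = lim_{t → 0} (1 - e^{-ta²}) / t` together with
Fatou's lemma and `1 - e^{-tb²} ≤ tb²`. -/
theorem lintegral_rpow_two_mul_le_of_heat {α β : Type*} [MeasurableSpace α] [MeasurableSpace β]
    {ν : Measure α} {ν' : Measure β} [SFinite ν] [SFinite ν'] {a : α → ℝ} {b : β → ℝ}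
    (ha : Measurable a) (hb : Measurable b) (ha0 : ∀ x, 0 ≤ a x) (hb0 : ∀ x, 0 ≤ b x)
    (h : ∀ t, 0 < t → ∫⁻ x, ENNReal.ofReal (1 - Real.exp (-(t * a x ^ 2))) ∂ν ≤
      ∫⁻ y, ENNReal.ofReal (1 - Real.exp (-(t * b y ^ 2))) ∂ν')
    {s : ℝ} (hs0 : 0 < s) (hs1 : s ≤ 1) :
    ∫⁻ x, ENNReal.ofReal (a x ^ (2 * s)) ∂ν ≤ ∫⁻ y, ENNReal.ofReal (b y ^ (2 * s)) ∂ν' := by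
  rcases hs1.lt_or_eq with hs1 | rfl
  · rw [← ENNReal.mul_le_mul_iff_right (subordinationConst_ne_zero s)
      (subordinationConst_ne_top hs0 hs1),
      subordinationConst_mul_lintegral hs0 ha ha0, subordinationConst_mul_lintegral hs0 hb hb0]
    exact setLIntegral_mono' measurableSet_Ioi fun t ht => mul_le_mul_right (h t ht) _
  · have hlim : ∀ x, Filter.Tendsto (fun n : ℕ => ENNReal.ofReal ((n + 1 : ℝ) *
        (1 - Real.exp (-(1 / (n + 1 : ℝ) * a x ^ 2))))) Filter.atTop
        (nhds (ENNReal.ofReal (a x ^ (2 * (1 : ℝ))))) := by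
      intro x
      refine ENNReal.tendsto_ofReal ?_
      have hd : HasDerivAt (fun t : ℝ => 1 - Real.exp (-(t * a x ^ 2))) (a x ^ 2) 0 := by
        simpa using ((hasDerivAt_id (0 : ℝ)).mul_const (a x ^ 2)).neg.exp.const_sub 1
      have ht : Filter.Tendsto (fun n : ℕ => 1 / ((n : ℝ) + 1)) Filter.atTop
          (nhdsWithin 0 (Set.Ioi 0)) :=
        tendsto_nhdsWithin_iff.2 ⟨tendsto_one_div_add_atTop_nhds_zero_nat,
          Filter.Eventually.of_forall fun n => by simp only [Set.mem_Ioi]; positivity⟩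
      simpa [Function.comp_def] using hd.tendsto_slope_zero_right.comp ht
    calc _ = ∫⁻ x, Filter.liminf (fun n : ℕ => ENNReal.ofReal ((n + 1 : ℝ) *
        (1 - Real.exp (-(1 / (n + 1 : ℝ) * a x ^ 2))))) Filter.atTop ∂ν :=
          lintegral_congr fun x => (hlim x).liminf_eq.symm
      _ ≤ Filter.liminf (fun n : ℕ => ∫⁻ x, ENNReal.ofReal ((n + 1 : ℝ) *
        (1 - Real.exp (-(1 / (n + 1 : ℝ) * a x ^ 2)))) ∂ν) Filter.atTop :=
          lintegral_liminf_le fun n => by fun_prop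
      _ ≤ _ := by
        refine Filter.liminf_le_of_le (by isBoundedDefault) fun c hc => ?_
        obtain ⟨n, hn⟩ := hc.exists
        refine hn.trans ?_
        have hn0 : (0 : ℝ) < n + 1 := by positivity
        simp_rw [ENNReal.ofReal_mul hn0.le]
        rw [lintegral_const_mul' _ _ ENNReal.ofReal_ne_top]
        refine (mul_le_mul_right (h _ (by positivity)) _).trans ?_
        rw [← lintegral_const_mul' _ _ ENNReal.ofReal_ne_top]
        refine lintegral_mono fun y => ?_
        rw [← ENNReal.ofReal_mul hn0.le]
        refine ENNReal.ofReal_le_ofReal ?_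
        have := Real.add_one_le_exp (-(1 / (n + 1 : ℝ) * b y ^ 2))
        calc _ ≤ (n + 1 : ℝ) * (1 / (n + 1 : ℝ) * b y ^ 2) := by gcongr; linarith
          _ = _ := by rw [mul_one, Real.rpow_two]; field_simp

end Subordination

/-! ### Data processing for the Hellinger affinity -/

section Affinity

theorem ENNReal.two_mul_rpow_half_le_add (a b : ℝ≥0∞) : 2 * (a * b) ^ (1 / 2 : ℝ) ≤ a + b := by
  have h := ENNReal.young_inequality (a ^ (1 / 2 : ℝ)) (b ^ (1 / 2 : ℝ))
    Real.HolderConjugate.two_two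
  rw [← ENNReal.mul_rpow_of_nonneg _ _ (by norm_num), ← ENNReal.rpow_mul, ← ENNReal.rpow_mul,
    ← ENNReal.add_div, ENNReal.le_div_iff_mul_le (by simp) (by simp)] at h
  simpa [mul_comm] using h

theorem ENNReal.mul_rpow_half_div_le {a : ℝ≥0∞} (b : ℝ≥0∞) (ha : a ≠ ∞) :
    a * (b / a) ^ (1 / 2 : ℝ) ≤ (a * b) ^ (1 / 2 : ℝ) := by
  rcases eq_or_ne a 0 with rfl | h0
  · simp
  · nth_rewrite 1 [← ENNReal.rpow_one a]
    rw [ENNReal.div_eq_inv_mul, ENNReal.mul_rpow_of_nonneg _ _ (by norm_num),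
      ENNReal.mul_rpow_of_nonneg _ _ (by norm_num), ← mul_assoc, ENNReal.inv_rpow,
      ← ENNReal.rpow_neg, ← ENNReal.rpow_add _ _ h0 ha]
    norm_num

variable {X Y : Type*} [MeasurableSpace X] [MeasurableSpace Y] {ν : Measure X} {ν' : Measure Y}

theorem lintegral_mul_comp_of_map_withDensity {π : X → Y} (hπ : Measurable π) {p : X → ℝ≥0∞}
    {p' : Y → ℝ≥0∞} (hp : Measurable p) (hp' : Measurable p')
    (h : (ν.withDensity p).map π = ν'.withDensity p') {φ : Y → ℝ≥0∞} (hφ : Measurable φ) :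
    ∫⁻ x, p x * φ (π x) ∂ν = ∫⁻ y, p' y * φ y ∂ν' := by
  have h1 := lintegral_withDensity_eq_lintegral_mul ν hp (hφ.comp hπ)
  have h2 := lintegral_withDensity_eq_lintegral_mul ν' hp' hφ
  simp only [Pi.mul_apply, Function.comp_apply] at h1 h2
  rw [← h1, ← h2, ← h, lintegral_map hφ hπ]

/-- Almost every point that `p` charges is mapped to a point where the density `p'` of the
pushforward is positive and finite. -/
theorem ae_density_comp_ne_of_map_withDensity {π : X → Y} (hπ : Measurable π) {p : X → ℝ≥0∞}
    {p' : Y → ℝ≥0∞} (hp : Measurable p) (hp' : Measurable p') (hfin : ∀ᵐ y ∂ν', p' y ≠ ∞)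
    (h : (ν.withDensity p).map π = ν'.withDensity p') :
    ∀ᵐ x ∂ν, p x ≠ 0 → p' (π x) ≠ 0 ∧ p' (π x) ≠ ∞ := by
  have h1 : ∀ᵐ y ∂(ν'.withDensity p'), p' y ≠ 0 ∧ p' y ≠ ∞ := by
    rw [ae_withDensity_iff hp']
    filter_upwards [hfin] with y hy h0 using ⟨h0, hy⟩
  rw [← h] at h1
  exact (ae_withDensity_iff hp).1 (ae_of_ae_map hπ.aemeasurable h1)

/-- Data processing for the Hellinger affinity: passing to the densities `p'`, `q'` of the
pushforwards under `π` does not decrease `∫ √(p q)`. For a function `φ` of `π x`,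
`2 √(p q) ≤ p φ + q φ⁻¹` has an integral that only involves the pushforwards, and the choice
`φ = √(q' / p')` makes it equal to `2 ∫ √(p' q')`. -/
theorem lintegral_sqrt_mul_le_of_map_withDensity {π : X → Y} (hπ : Measurable π)
    {p q : X → ℝ≥0∞} {p' q' : Y → ℝ≥0∞} (hp : Measurable p) (hq : Measurable q)
    (hp' : Measurable p') (hq' : Measurable q')
    (hpfin : ∀ᵐ y ∂ν', p' y ≠ ∞) (hqfin : ∀ᵐ y ∂ν', q' y ≠ ∞)
    (hpp : (ν.withDensity p).map π = ν'.withDensity p')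
    (hqq : (ν.withDensity q).map π = ν'.withDensity q') :
    ∫⁻ x, (p x * q x) ^ (1 / 2 : ℝ) ∂ν ≤ ∫⁻ y, (p' y * q' y) ^ (1 / 2 : ℝ) ∂ν' := by
  set φ : Y → ℝ≥0∞ := fun y => (q' y / p' y) ^ (1 / 2 : ℝ) with hφ
  set ψ : Y → ℝ≥0∞ := fun y => (p' y / q' y) ^ (1 / 2 : ℝ) with hψ
  have hφm : Measurable φ := by fun_prop
  have hψm : Measurable ψ := by fun_prop
  have h2 : 2 * ∫⁻ x, (p x * q x) ^ (1 / 2 : ℝ) ∂ν ≤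
      2 * ∫⁻ y, (p' y * q' y) ^ (1 / 2 : ℝ) ∂ν' := by
    calc 2 * ∫⁻ x, (p x * q x) ^ (1 / 2 : ℝ) ∂ν
        = ∫⁻ x, 2 * (p x * q x) ^ (1 / 2 : ℝ) ∂ν := (lintegral_const_mul' _ _ (by simp)).symm
      _ ≤ ∫⁻ x, (p x * φ (π x) + q x * ψ (π x)) ∂ν := by
          refine lintegral_mono_ae ?_
          filter_upwards [ae_density_comp_ne_of_map_withDensity hπ hp hp' hpfin hpp,
            ae_density_comp_ne_of_map_withDensity hπ hq hq' hqfin hqq] with x h1 h2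
          -- Where `p` and `q` are positive, `p' ∘ π` and `q' ∘ π` are a.e. positive and finite.
          by_cases hp0 : p x = 0
          · simp [hp0]
          by_cases hq0 : q x = 0
          · simp [hq0]
          obtain ⟨a0, a1⟩ := h1 hp0
          obtain ⟨b0, b1⟩ := h2 hq0
          have hφψ : φ (π x) * ψ (π x) = 1 := by
            rw [hφ, hψ]
            dsimp only
            rw [← ENNReal.mul_rpow_of_nonneg _ _ (by norm_num), ← ENNReal.inv_div (by simp [b1])
              (by simp [b0]), ENNReal.inv_mul_cancel
                (ENNReal.div_ne_zero.2 ⟨a0, b1⟩) (ENNReal.div_ne_top a1 b0), ENNReal.one_rpow]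
          refine le_trans (le_of_eq ?_) (ENNReal.two_mul_rpow_half_le_add _ _)
          rw [mul_mul_mul_comm, hφψ, mul_one]
      _ = ∫⁻ y, p' y * φ y ∂ν' + ∫⁻ y, q' y * ψ y ∂ν' := by
          rw [lintegral_add_left (by fun_prop),
            lintegral_mul_comp_of_map_withDensity hπ hp hp' hpp hφm,
            lintegral_mul_comp_of_map_withDensity hπ hq hq' hqq hψm]
      _ ≤ ∫⁻ y, (p' y * q' y) ^ (1 / 2 : ℝ) ∂ν' + ∫⁻ y, (p' y * q' y) ^ (1 / 2 : ℝ) ∂ν' := by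
          gcongr ?_ + ?_
          · refine lintegral_mono_ae ?_
            filter_upwards [hpfin] with y hy using ENNReal.mul_rpow_half_div_le _ hy
          · refine lintegral_mono_ae ?_
            filter_upwards [hqfin] with y hy
            rw [mul_comm (p' y)]
            exact ENNReal.mul_rpow_half_div_le _ hy
      _ = _ := (two_mul _).symm
  exact (ENNReal.mul_le_mul_iff_right (by simp) (by simp)).1 h2

/-- The identity `(√a - √b)² + 2 √(a b) = a + b` for finite extended nonnegative numbers. -/
theorem ofReal_sq_sqrt_sub_sqrt_add {a b : ℝ≥0∞} (ha : a ≠ ∞) (hb : b ≠ ∞) :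
    ENNReal.ofReal (‖(Real.sqrt a.toReal : ℂ) - (Real.sqrt b.toReal : ℂ)‖ ^ 2) +
      2 * (a * b) ^ (1 / 2 : ℝ) = a + b := by
  lift a to NNReal using ha
  lift b to NNReal using hb
  rw [← Complex.ofReal_sub, Complex.norm_real, Real.norm_eq_abs, sq_abs, ← ENNReal.coe_mul,
    ← ENNReal.coe_rpow_of_nonneg _ (by norm_num), ← NNReal.sqrt_eq_rpow, ← ENNReal.coe_add]
  have h2 (c : NNReal) : (c : ℝ≥0∞) = ENNReal.ofReal (c : ℝ) := ENNReal.ofReal_coe_nnreal.symm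
  rw [h2 (NNReal.sqrt _), h2 (a + b), ← ENNReal.ofReal_ofNat,
    ← ENNReal.ofReal_mul (by norm_num), ← ENNReal.ofReal_add (by positivity) (by positivity)]
  congr 1
  simp only [ENNReal.coe_toReal, NNReal.coe_add, Real.coe_sqrt, NNReal.coe_mul,
    Real.sqrt_mul a.coe_nonneg]
  linear_combination Real.sq_sqrt a.coe_nonneg + Real.sq_sqrt b.coe_nonneg

theorem map_add_neg_right_withDensity {E : Type*} [AddGroup E] [MeasurableSpace E] [MeasurableAdd E]
    {ν : Measure E} [ν.IsAddRightInvariant] (p : E → ℝ≥0∞) (hp : Measurable p) (v : E) :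
    (ν.withDensity p).map (· + -v) = ν.withDensity fun x => p (x + v) := by
  have hm : Measurable fun x : E => x + -v := measurable_add_const _
  ext A hA
  rw [Measure.map_apply hm hA, withDensity_apply _ (hm hA), withDensity_apply _ hA,
    ← (measurePreserving_add_right ν v).setLIntegral_comp_preimage (hm hA) hp]
  congr 2
  ext x
  simp

end Affinity

/-! ### Translates of `√μ` and of the root of a marginal density -/

section Particles

variable {d N n : ℕ}

/-- The configuration whose `j`-th particle is at `h` and whose other particles are at the origin;
adding it displaces particle `j` by `h`. -/
noncomputable def Config.single (j : Fin N) (h : EuclideanSpace ℝ (Fin d)) : Config d N :=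
  WithLp.toLp 2 fun p => if p.1 = j then h p.2 else 0

theorem Config.inner_single (j : Fin N) (h : EuclideanSpace ℝ (Fin d)) (k : Config d N) :
    inner ℝ (Config.single j h) k = inner ℝ h (k.particle j) := by
  simp [Config.single, Config.particle, PiLp.inner_apply, Fintype.sum_prod_type_right]

theorem Config.reindex_single {ι : Fin n → Fin N} (hι : Function.Injective ι) (j : Fin n)
    (h : EuclideanSpace ℝ (Fin d)) :
    Config.reindex ι (Config.single (ι j) h) = Config.single j h := by
  ext p
  simp [Config.reindex, Config.single, hι.eq_iff]

theorem Config.measurable_particle (j : Fin N) :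
    Measurable fun k : Config d N => k.particle j := by
  unfold Config.particle
  fun_prop

/-- `Config.reindex` as a linear map. -/
noncomputable def Config.reindexₗ (f : Fin n → Fin N) : Config d N →ₗ[ℝ] Config d n where
  toFun := Config.reindex f
  map_add' _ _ := rfl
  map_smul' _ _ := rfl

theorem Config.reindexₗ_surjective {ι : Fin n → Fin N} (hι : Function.Injective ι) :
    Function.Surjective (Config.reindexₗ ι : Config d N →ₗ[ℝ] Config d n) := by
  intro y
  refine ⟨WithLp.toLp 2 fun p => Function.extend (Prod.map ι id) (fun q => y q) 0 p, ?_⟩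
  ext p
  exact (hι.prodMap Function.injective_id).extend_apply (fun q => y q) 0 p

/-- Selecting distinct particles is a surjective linear map, so it preserves absolute continuity. -/
theorem Config.map_reindex_absolutelyContinuous {ι : Fin n → Fin N} (hι : Function.Injective ι)
    {μ : Measure (Config d N)} (hμ : μ ≪ volume) :
    μ.map (Config.reindex ι) ≪ (volume : Measure (Config d n)) := by
  refine (hμ.map (Config.measurable_reindex ι)).trans ?_
  refine Measure.AbsolutelyContinuous.mk fun A hA h0 => ?_
  have h1 := (ae_comp_linearMap_mem_iff (Config.reindexₗ (d := d) ι) volume volume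
    (Config.reindexₗ_surjective hι) hA.compl).2 (measure_eq_zero_iff_ae_notMem.1 h0)
  rw [Measure.map_apply (Config.measurable_reindex ι) hA]
  exact measure_eq_zero_iff_ae_notMem.2 h1

variable (μ : ProbabilityMeasure (Config d N))

theorem withDensity_rnDeriv_volume (hμ : (μ : Measure (Config d N)) ≪ volume) :
    volume.withDensity ((μ : Measure (Config d N)).rnDeriv volume) = μ :=
  haveI : SigmaFinite (volume : Measure (Config d N)) := inferInstance
  haveI : SFinite (μ : Measure (Config d N)) := inferInstance
  Measure.withDensity_rnDeriv_eq (μ : Measure (Config d N)) volume hμ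

/-- Since `μ` and its translates have mass one, `‖√μ(· + v) - √μ‖² = 2 - 2 ∫ √(μ(· + v) μ)`. -/
theorem lintegral_sqrtDensity_translate_sub (hμ : (μ : Measure (Config d N)) ≪ volume)
    (v : Config d N) :
    (∫⁻ x, ENNReal.ofReal (‖sqrtDensity μ (x + v) - sqrtDensity μ x‖ ^ 2)) +
      2 * ∫⁻ x, ((μ : Measure (Config d N)).rnDeriv volume (x + v) *
        (μ : Measure (Config d N)).rnDeriv volume x) ^ (1 / 2 : ℝ) = 2 := by
  set p := (μ : Measure (Config d N)).rnDeriv volume with hp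
  have hpm : Measurable p := Measure.measurable_rnDeriv _ _
  have hv := measurePreserving_add_right (volume : Measure (Config d N)) v
  have hfin : ∀ᵐ x : Config d N, p x ≠ ∞ := Measure.rnDeriv_ne_top _ _
  have hf : ⇑(sqrtDensity μ) =ᵐ[volume] sqrtDensityFun μ := (memLp_sqrtDensityFun μ).coeFn_toLp
  have hone : ∫⁻ x, p x = 1 := by
    rw [← setLIntegral_univ, ← withDensity_apply _ MeasurableSet.univ,
      withDensity_rnDeriv_volume μ hμ, measure_univ]
  have hpv : Measurable fun x => p (x + v) := hpm.comp hv.measurable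
  rw [← lintegral_const_mul _ (by fun_prop), ← lintegral_add_right _ (by fun_prop :
    Measurable fun x => 2 * (p (x + v) * p x) ^ (1 / 2 : ℝ))]
  calc _ = ∫⁻ x, (p (x + v) + p x) := by
        refine lintegral_congr_ae ?_
        filter_upwards [hfin, hv.quasiMeasurePreserving.ae hfin, hf,
          hv.quasiMeasurePreserving.ae_eq_comp hf] with x h1 h2 h3 h4
        rw [← ofReal_sq_sqrt_sub_sqrt_add h2 h1, h3]
        simp only [Function.comp_apply] at h4
        rw [h4]
        rfl
    _ = 2 := by
        rw [lintegral_add_right _ hpm, hv.lintegral_comp hpm, hone, one_add_one_eq_two]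

/-- For the law `μ'` of distinct particles under `μ`, the distance in `L²` from `√μ'` to a translate
is at most the distance from `√μ` to the corresponding translate. Translations commute with
`Config.reindex ι`, so this is the data processing inequality for `μ` and its translate. -/
theorem lintegral_sqrtDensity_map_reindex_translate_sub_le {ι : Fin n → Fin N}
    (hι : Function.Injective ι) (hμ : (μ : Measure (Config d N)) ≪ volume) (v : Config d N) :
    ∫⁻ y, ENNReal.ofReal (‖sqrtDensity (μ.map (Config.measurable_reindex ι).aemeasurable)
          (y + Config.reindex ι v) -
        sqrtDensity (μ.map (Config.measurable_reindex ι).aemeasurable) y‖ ^ 2) ≤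
      ∫⁻ x, ENNReal.ofReal (‖sqrtDensity μ (x + v) - sqrtDensity μ x‖ ^ 2) := by
  set μ' := μ.map (Config.measurable_reindex (d := d) ι).aemeasurable with hμ'
  have hmap : (μ' : Measure (Config d n)) = (μ : Measure (Config d N)).map (Config.reindex ι) :=
    rfl
  have hac : (μ' : Measure (Config d n)) ≪ volume :=
    hmap ▸ Config.map_reindex_absolutelyContinuous hι hμ
  have h1 := lintegral_sqrtDensity_translate_sub μ hμ v
  have h2 := lintegral_sqrtDensity_translate_sub μ' hac (Config.reindex ι v)
  set p := (μ : Measure (Config d N)).rnDeriv volume with hp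
  set p' := (μ' : Measure (Config d n)).rnDeriv volume with hp'
  have hpm : Measurable p := Measure.measurable_rnDeriv _ _
  have hpm' : Measurable p' := Measure.measurable_rnDeriv _ _
  have hfin : ∀ᵐ x : Config d n, p' x ≠ ∞ := Measure.rnDeriv_ne_top _ _
  have hv' := measurePreserving_add_right (volume : Measure (Config d n)) (Config.reindex ι v)
  have hpp : (volume.withDensity p).map (Config.reindex ι) = volume.withDensity p' := by
    rw [withDensity_rnDeriv_volume μ hμ, withDensity_rnDeriv_volume μ' hac, hmap]
  have haff : ∫⁻ x, (p (x + v) * p x) ^ (1 / 2 : ℝ) ≤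
      ∫⁻ y, (p' (y + Config.reindex ι v) * p' y) ^ (1 / 2 : ℝ) := by
    refine lintegral_sqrt_mul_le_of_map_withDensity (Config.measurable_reindex ι)
      (p := fun x => p (x + v)) (p' := fun y => p' (y + Config.reindex ι v))
      (hpm.comp (measurable_add_const _)) hpm (hpm'.comp (measurable_add_const _)) hpm'
      (hv'.quasiMeasurePreserving.ae hfin) hfin ?_ hpp
    rw [← map_add_neg_right_withDensity p hpm, ← map_add_neg_right_withDensity p' hpm', ← hpp,
      Measure.map_map (Config.measurable_reindex ι) (measurable_add_const _),
      Measure.map_map (measurable_add_const _) (Config.measurable_reindex ι)]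
    rfl
  have hne : 2 * ∫⁻ y, (p' (y + Config.reindex ι v) * p' y) ^ (1 / 2 : ℝ) ≠ ∞ :=
    ne_top_of_le_ne_top ENNReal.ofNat_ne_top (le_add_self.trans_eq h2)
  refine (ENNReal.add_le_add_iff_right hne).1 ?_
  exact (h2.trans h1.symm).trans_le (add_le_add_right (mul_le_mul_right haff 2) _)

end Particles

/-! ### Kinetic forms of marginals -/

section Kinetic

variable {d N n : ℕ}

/-- The measure `|𝓕 Ψ(k)|² dk` on momentum space. -/
noncomputable def fourierDensity (Ψ : Lp ℂ 2 (volume : Measure (Config d N))) :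
    Measure (Config d N) :=
  volume.withDensity fun k =>
    ENNReal.ofReal (‖(𝓕 Ψ : Lp ℂ 2 (volume : Measure (Config d N))) k‖ ^ 2)

theorem measurable_ofReal_norm_fourier_sq (Ψ : Lp ℂ 2 (volume : Measure (Config d N))) :
    Measurable fun k => ENNReal.ofReal (‖(𝓕 Ψ : Lp ℂ 2 (volume : Measure (Config d N))) k‖ ^ 2) :=
  ((Lp.stronglyMeasurable _).norm.measurable.pow_const 2).ennreal_ofReal

instance (Ψ : Lp ℂ 2 (volume : Measure (Config d N))) : SFinite (fourierDensity Ψ) := by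
  unfold fourierDensity; infer_instance

theorem lintegral_fourierDensity (Ψ : Lp ℂ 2 (volume : Measure (Config d N)))
    {g : Config d N → ℝ≥0∞} (hg : Measurable g) :
    ∫⁻ k, g k ∂fourierDensity Ψ = ∫⁻ k, g k *
      ENNReal.ofReal (‖(𝓕 Ψ : Lp ℂ 2 (volume : Measure (Config d N))) k‖ ^ 2) := by
  rw [fourierDensity,
    lintegral_withDensity_eq_lintegral_mul _ (measurable_ofReal_norm_fourier_sq Ψ) hg]
  simp only [Pi.mul_apply, mul_comm]

theorem kineticForm_eq_lintegral_fourierDensity (s : ℝ) (j : Fin N)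
    (Ψ : Lp ℂ 2 (volume : Measure (Config d N))) :
    kineticForm s j Ψ = ∫⁻ k, ENNReal.ofReal ((2 * Real.pi * ‖k.particle j‖) ^ (2 * s))
      ∂fourierDensity Ψ := by
  have := Config.measurable_particle (d := d) j
  rw [lintegral_fourierDensity Ψ (by fun_prop), kineticForm]
  exact lintegral_congr fun k => ENNReal.ofReal_mul (by positivity)

theorem measurable_fourierChar_sub_one_sq :
    Measurable fun x : ℝ => ENNReal.ofReal (‖((𝐞 x : Circle) : ℂ) - 1‖ ^ 2) :=
  ENNReal.measurable_ofReal.comp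
    (((continuous_subtype_val.comp Real.continuous_fourierChar).sub
      continuous_const).norm.pow 2).measurable

theorem Config.measurable_fourierChar_single (j : Fin N) (c : ℝ) :
    Measurable fun z : EuclideanSpace ℝ (Fin d) × Config d N => ENNReal.ofReal
      (‖((𝐞 (inner ℝ (c • z.1) (z.2.particle j)) : Circle) : ℂ) - 1‖ ^ 2) := by
  have hpm := Config.measurable_particle (d := d) j
  have h2 : Measurable fun z : EuclideanSpace ℝ (Fin d) × Config d N =>
      inner ℝ (c • z.1) (z.2.particle j) := by fun_prop
  exact measurable_fourierChar_sub_one_sq.comp h2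

theorem lintegral_fourierChar_single_fourierDensity (j : Fin N)
    (Ψ : Lp ℂ 2 (volume : Measure (Config d N))) (c : ℝ) (h : EuclideanSpace ℝ (Fin d)) :
    ∫⁻ k, ENNReal.ofReal (‖((𝐞 (inner ℝ (c • h) (k.particle j)) : Circle) : ℂ) - 1‖ ^ 2)
      ∂fourierDensity Ψ =
    ∫⁻ x, ENNReal.ofReal (‖Ψ (x + Config.single j (c • h)) - Ψ x‖ ^ 2) := by
  rw [← lintegral_norm_fourierChar_sub_one_sq]
  simp_rw [Config.inner_single]
  have hpm := Config.measurable_particle (d := d) j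
  have hm : Measurable fun k : Config d N => inner ℝ (c • h) (k.particle j) := by fun_prop
  exact lintegral_fourierDensity Ψ (measurable_fourierChar_sub_one_sq.comp hm)

open ProbabilityTheory in
/-- Twice the quadratic form of `1 - e^{tΔ_j}` is the mean, over Gaussian displacements of particle
`j`, of the squared distance from `Ψ` to its translate. The Gaussian has variance `2t` in each direction. -/
theorem two_mul_lintegral_heat_fourierDensity (j : Fin N)
    (Ψ : Lp ℂ 2 (volume : Measure (Config d N))) {t : ℝ} (ht : 0 < t) :
    2 * ∫⁻ k, ENNReal.ofReal (1 - Real.exp (-(t * (2 * Real.pi * ‖k.particle j‖) ^ 2)))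
      ∂fourierDensity Ψ =
    ∫⁻ h, (∫⁻ x, ENNReal.ofReal (‖Ψ (x + Config.single j (√(2 * t) • h)) - Ψ x‖ ^ 2))
      ∂stdGaussian (EuclideanSpace ℝ (Fin d)) := by
  have hg (k : Config d N) :
      2 * ENNReal.ofReal (1 - Real.exp (-(t * (2 * Real.pi * ‖k.particle j‖) ^ 2))) =
      ∫⁻ h, ENNReal.ofReal
        (‖((𝐞 (inner ℝ (√(2 * t) • h) (k.particle j)) : Circle) : ℂ) - 1‖ ^ 2)
        ∂stdGaussian (EuclideanSpace ℝ (Fin d)) := by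
    have hsq := Real.sq_sqrt (show 0 ≤ 2 * t by positivity)
    have he : -(2 * Real.pi * √(2 * t) * ‖k.particle j‖) ^ 2 / 2 =
        -(t * (2 * Real.pi * ‖k.particle j‖) ^ 2) := by
      linear_combination (-2 * (Real.pi * ‖k.particle j‖) ^ 2) * hsq
    rw [lintegral_stdGaussian_fourierChar_sub_one, he, ENNReal.ofReal_mul (by norm_num),
      ENNReal.ofReal_ofNat]
  rw [← lintegral_const_mul' _ _ ENNReal.ofNat_ne_top, lintegral_congr hg]
  refine (lintegral_lintegral_swap (f := fun (k : Config d N) (h : EuclideanSpace ℝ (Fin d)) =>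
    ENNReal.ofReal (‖((𝐞 (inner ℝ (√(2 * t) • h) (k.particle j)) : Circle) : ℂ) - 1‖ ^ 2))
    ((Config.measurable_fourierChar_single j _).comp measurable_swap).aemeasurable).trans ?_
  exact lintegral_congr fun h => lintegral_fourierChar_single_fourierDensity j Ψ _ h

/-- The kinetic energy of a particle in the root of a marginal density is at most its kinetic energy
in `√μ`: this holds for the forms of `1 - e^{tΔ_j}`, hence for those of `(-Δ_j)^s`. -/
theorem kineticForm_sqrtDensity_map_reindex_le {ι : Fin n → Fin N}
    (hι : Function.Injective ι) (μ : ProbabilityMeasure (Config d N))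
    (hμ : (μ : Measure (Config d N)) ≪ volume) {s : ℝ} (hs0 : 0 < s) (hs1 : s ≤ 1) (j : Fin n) :
    kineticForm s j (sqrtDensity (μ.map (Config.measurable_reindex ι).aemeasurable)) ≤
      kineticForm s (ι j) (sqrtDensity μ) := by
  have h1 := Config.measurable_particle (d := d) j
  have h2 := Config.measurable_particle (d := d) (ι j)
  rw [kineticForm_eq_lintegral_fourierDensity, kineticForm_eq_lintegral_fourierDensity]
  refine lintegral_rpow_two_mul_le_of_heat (by fun_prop) (by fun_prop)
    (fun k => by positivity) (fun k => by positivity) (fun t ht => ?_) hs0 hs1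
  refine (ENNReal.mul_le_mul_iff_right two_ne_zero ENNReal.ofNat_ne_top).1 ?_
  rw [two_mul_lintegral_heat_fourierDensity _ _ ht, two_mul_lintegral_heat_fourierDensity _ _ ht]
  refine lintegral_mono fun h => ?_
  have := lintegral_sqrtDensity_map_reindex_translate_sub_le μ hι hμ
    (Config.single (ι j) (√(2 * t) • h))
  rwa [Config.reindex_single hι] at this

theorem fisherInformation_map_reindex_le {ι : Fin n → Fin N}
    (hι : Function.Injective ι) (μ : ProbabilityMeasure (Config d N))
    (hμ : (μ : Measure (Config d N)) ≪ volume) {s : ℝ} (hs0 : 0 < s) (hs1 : s ≤ 1) :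
    fisherInformation s (μ.map (Config.measurable_reindex ι).aemeasurable) ≤
      ∑ j, kineticForm s (ι j) (sqrtDensity μ) := by
  have hac : ((μ.map (Config.measurable_reindex (d := d) ι).aemeasurable :
      ProbabilityMeasure (Config d n)) : Measure (Config d n)) ≪ volume :=
    Config.map_reindex_absolutelyContinuous hι hμ
  rw [fisherInformation, if_pos hac]
  exact Finset.sum_le_sum fun j _ => kineticForm_sqrtDensity_map_reindex_le hι μ hμ hs0 hs1 j

end Kinetic

/-! ### Symmetric measures and superadditivity -/

/-- By symmetry, any `m` distinct particles have the same joint law as the first `m`. -/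
theorem IsSymmetric.map_reindex_eq_marginal {d N m : ℕ} {μ : ProbabilityMeasure (Config d N)}
    (hμ : IsSymmetric μ) (hm : m ≤ N) {ι : Fin m → Fin N} (hι : Function.Injective ι) :
    μ.map (Config.measurable_reindex ι).aemeasurable = marginal μ m hm := by
  obtain ⟨σ, hσ⟩ := Equiv.Perm.exists_smul_eq_embedding (Fin.castLEEmb hm) ⟨ι, hι⟩
  have h1 : Config.reindex (d := d) ι =
      Config.reindex (Fin.castLE hm) ∘ Config.reindex (σ : Fin N → Fin N) := by
    funext x
    ext p
    exact congrArg (fun k => x (k, p.2)) (DFunLike.congr_fun hσ p.1).symm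
  have h2 : (μ : Measure (Config d N)).map (Config.reindex (σ : Fin N → Fin N)) = μ :=
    congrArg Subtype.val (hμ σ)
  apply Subtype.ext
  change (μ : Measure (Config d N)).map _ = (μ : Measure (Config d N)).map _
  conv_rhs => rw [← h2]
  rw [Measure.map_map (Config.measurable_reindex _) (Config.measurable_reindex _), h1]

theorem mainTheorem1 (d N n : ℕ) (hn : n < N) (s : ℝ) (hs0 : 0 < s) (hs1 : s ≤ 1)
    (μ : ProbabilityMeasure (Config d N)) (hμ : IsSymmetric μ) :
    fisherInformation s (marginal μ n hn.le) +
        fisherInformation s (marginal μ (N - n) (Nat.sub_le N n)) ≤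
      fisherInformation s μ := by
  by_cases hac : (μ : Measure (Config d N)) ≪ volume
  · obtain ⟨m, rfl⟩ := Nat.exists_eq_add_of_le hn.le
    -- The second marginal is realised by the last `N - n` particles, disjoint from the first `n`.
    have hι : Function.Injective fun i : Fin (n + m - n) =>
        Fin.natAdd n (Fin.cast (Nat.add_sub_cancel_left n m) i) := fun i j h => by
      simpa using h
    rw [← hμ.map_reindex_eq_marginal (Nat.sub_le _ n) hι]
    rw [fisherInformation.eq_1 s μ, if_pos hac, Fin.sum_univ_add]
    refine add_le_add (fisherInformation_map_reindex_le (Fin.castLE_injective _) μ hac hs0 hs1) ?_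
    refine (fisherInformation_map_reindex_le hι μ hac hs0 hs1).trans_eq ?_
    exact Fintype.sum_equiv (finCongr (Nat.add_sub_cancel_left n m)) _ _ fun _ => rfl
  · rw [fisherInformation.eq_1 s μ, if_neg hac]
    exact le_top
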